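/- Let $X$ be a reflexive real Banach space with dual $X^*$, let $T$ be an arbitrary index set, and let $f_t:X\to\mathbb{R}\cup\{\infty\}$, $t\in T$, be proper lower semicontinuous convex functions. Let $l_\infty(T)$ be the Banach space of bounded functions $p=(p_t)_{t\in T}:T\to\mathbb{R}$ with the supremum norm, and let $\mathcal{F}:l_\infty(T)\rightrightarrows X$ be the feasible solution map $$\mathcal{F}(p):=\{x\in X \mid f_t(x)\le p_t \text{ for all } t\in T\}.$$ A point $\widehat{x}\in X$ is a \emph{strong Slater point} if $\sup_{t\in T}f_t(\widehat{x})<0$ (with $\sup\varnothing=-\infty$ here). The conjugate of $f_t$ is $f_t^*(u^*):=\sup_{x\in X}\{\langle u^*,x\rangle-f_t(x)\}$ for $u^*\in X^*$, and $$C(0):=\mathrm{co}\Big(\bigcup_{t\in T}\mathrm{gph}\, f_t^*\Big)\subset X^*\times\mathbb{R},$$ where $\mathrm{co}$ is the convex hull and $\mathrm{gph}\, f_t^*=\{(u^*,f_t^*(u^*)) \mid f_t^*(u^*)<\infty\}$. Let $\mathrm{cl}^*$ denote the closure in $X^*\times\mathbb{R}$ for the product of the weak$^*$ topology of $X^*$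 and the usual topology of $\mathbb{R}$. For $\bar{x}\in\mathcal{F}(0)$, the \emph{exact Lipschitzian bound} $\mathrm{lip}\,\mathcal{F}(0,\bar{x})\in[0,\infty]$ is the infimum (with $\inf\varnothing=\infty$) of all $\ell\ge 0$ for which there are neighborhoods $U$ of $0\in l_\infty(T)$ and $V$ of $\bar{x}$ such that $$\mathcal{F}(p)\cap V\subset\mathcal{F}(q)+\ell\,\|p-q\|\,\mathbb{B}\quad\text{for all } p,q\in U,$$ where $\mathbb{B}$ is the closed unit ball of $X$. Let $\bar{x}\in\mathcal{F}(0)$ and assume that the strong Slater condition holds, i.e. that a strong Slater point exists. No boundedness of $\bigcup_{t\in T}\mathrm{dom}\, f_t^*$ is assumed. Then: (i) if $\bar{x}$ is a strong Slater point, then $\mathrm{lip}\,\mathcal{F}(0,\bar{x})=0$; (ii) if $\bar{x}$ is not a strong Slater point, then $$\mathrm{lip}\,\mathcal{F}(0,\bar{x})=\sup\big\{\|u^*\|^{-1} \;\big|\; (u^*,\langle u^*,\bar{x}\rangle)\in\mathrm{cl}^*C(0)\big\},$$ with the conventions $\sup\varnothing:=0$ and $0^{-1}:=\infty$. -/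

import Mathlib

open Set Topology Pointwise
open scoped NNReal ENNReal

namespace ConvexSystem

/-- The set-valued mapping `F : Z ⇉ Y` is Lipschitz-like around `(z, y)` with modulus `ℓ ≥ 0`. -/
def LipschitzLikeWith {Z Y : Type*} [NormedAddCommGroup Z]
    [NormedAddCommGroup Y] [NormedSpace ℝ Y] (F : Z → Set Y) (z : Z) (y : Y) (ℓ : ℝ≥0) : Prop :=
  ∃ U ∈ 𝓝 z, ∃ V ∈ 𝓝 y, ∀ z₁ ∈ U, ∀ z₂ ∈ U,
    F z₁ ∩ V ⊆ F z₂ + ((ℓ : ℝ) * ‖z₁ - z₂‖) • Metric.closedBall (0 : Y) 1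

/-- The exact Lipschitzian bound: the infimum of all moduli (`∞` if there is none). -/
noncomputable def lip {Z Y : Type*} [NormedAddCommGroup Z]
    [NormedAddCommGroup Y] [NormedSpace ℝ Y] (F : Z → Set Y) (z : Z) (y : Y) : ℝ≥0∞ :=
  ⨅ (ℓ : ℝ≥0) (_ : LipschitzLikeWith F z y ℓ), (ℓ : ℝ≥0∞)

/-- A normed space is reflexive if its canonical map into the bidual is onto. -/
def IsReflexive (X : Type*) [NormedAddCommGroup X] [NormedSpace ℝ X] : Prop :=
  Function.Surjective (NormedSpace.inclusionInDoubleDual ℝ X)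

/-- The effective domain. -/
def effDom {X : Type*} (g : X → EReal) : Set X := {x | g x < ⊤}

/-- The epigraph, a subset of `X × ℝ`. -/
def epi {X : Type*} (g : X → EReal) : Set (X × ℝ) := {q | g q.1 ≤ (q.2 : EReal)}

/-- The graph over the points where the function is finite, a subset of `X × ℝ`. -/
def gph {X : Type*} (g : X → EReal) : Set (X × ℝ) := {q | g q.1 = (q.2 : EReal)}

/-- Proper lower semicontinuous convex functions `g : X → ℝ ∪ {∞}`. -/
structure IsProperLscConvex {X : Type*} [NormedAddCommGroup X] [NormedSpace ℝ X]
    (g : X → EReal) : Prop where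
  ne_bot : ∀ x, g x ≠ ⊥
  nonempty_effDom : (effDom g).Nonempty
  lsc : LowerSemicontinuous g
  convex : Convex ℝ (epi g)

/-- The Fenchel-Legendre conjugate. -/
noncomputable def conjugate {X : Type*} [NormedAddCommGroup X] [NormedSpace ℝ X]
    (g : X → EReal) (u : StrongDual ℝ X) : EReal :=
  ⨆ x : X, ((u x : ℝ) : EReal) - g x

/-- The parameter space of all bounded functions `T → ℝ` with the supremum norm. -/
abbrev LInfty (T : Type*) : Type _ := lp (fun _ : T => ℝ) ∞

/-- The feasible solution map `p ↦ {x | f_t(x) ≤ p_t for all t}`. -/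
def feasible {X T : Type*} (f : T → X → EReal) (p : LInfty T) : Set X :=
  {x | ∀ t, f t x ≤ ((p t : ℝ) : EReal)}

/-- `x` is a strong Slater point of the nominal system: `sup_t f_t(x) < 0`. -/
def IsStrongSlaterPoint {X T : Type*} (f : T → X → EReal) (x : X) : Prop :=
  (⨆ t, f t x) < 0

/-- The strong Slater condition for the nominal system. -/
def StrongSlaterCondition {X T : Type*} (f : T → X → EReal) : Prop :=
  ∃ x, IsStrongSlaterPoint f x

/-- The characteristic set `C(p) = co ⋃_t gph (f_t - p_t)^*` in `X^* × ℝ`. -/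
noncomputable def charSet {X T : Type*} [NormedAddCommGroup X] [NormedSpace ℝ X]
    (f : T → X → EReal) (p : LInfty T) : Set (StrongDual ℝ X × ℝ) :=
  convexHull ℝ (⋃ t, gph (conjugate fun x => f t x - ((p t : ℝ) : EReal)))

/-- The closure of a subset of `X^* × ℝ` in the product of the weak* topology and the usual
topology of `ℝ`. -/
def weakStarClosure {X : Type*} [NormedAddCommGroup X] [NormedSpace ℝ X]
    (S : Set (StrongDual ℝ X × ℝ)) : Set (StrongDual ℝ X × ℝ) :=
  {q | (StrongDual.toWeakDual q.1, q.2) ∈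
    closure ((fun r : StrongDual ℝ X × ℝ => (StrongDual.toWeakDual r.1, r.2)) '' S)}

end ConvexSystem

namespace ConvexSystem

section Aux

/-! Let `φ = sup_t f_t`. By separation, `(u, u x)` lies in the weak* closure of `C(0)` exactly when
`u y - u x ≤ φ y` for all `y` (`mem_supSubdiff_iff`), so the claim is that `lip` is the supremum of
`‖u‖⁻¹` over such `u`. Lower bound: compare `p = 0` with the constant perturbation `-ε`. Reaching
`{φ ≤ -ε}` within distance `ℓ ε` forces `u` to drop by `ε`, so `1 ≤ ℓ ‖u‖`. Upper bound: if all
these `u` have norm above `ℓ⁻¹`, weak* compactness extends this to `ε`-subgradients. A point of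
`F(p)` too far from `F(q)` would, by separating a ball from the perturbed epigraph, yield an
`ε`-subgradient of norm at most `ℓ⁻¹`. At a strong Slater point no such `u` exists, so the supremum
is `0`. -/

theorem inv_neg_mul_add {a : ℝ} (ha : a < 0) (b c : ℝ) :
    (-a)⁻¹ * (b + a * c) = (-a)⁻¹ * b - c := by
  have := ha.ne
  rw [inv_neg, mul_add, neg_mul, neg_mul, inv_mul_cancel_left₀ this, sub_eq_add_neg]

/-! ### Conjugacy for a single function -/

variable {X : Type*} [NormedAddCommGroup X] [NormedSpace ℝ X]

/-- A point strictly below a proper lower semicontinuous convex function is separated from its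
epigraph by a closed hyperplane, possibly a vertical one. -/
theorem IsProperLscConvex.exists_separation {g : X → EReal} (hg : IsProperLscConvex g) {x : X}
    {c : ℝ} (hc : (c : EReal) < g x) :
    ∃ (w : StrongDual ℝ X) (a d : ℝ), (∀ y μ, g y ≤ ((μ : ℝ) : EReal) → w y + a * μ ≤ d) ∧
      d < w x + a * c ∧ a ≤ 0 := by
  have hcl : IsClosed (epi g) := by
    have h := hg.lsc.isClosed_epigraph
    have : epi g = (fun q : X × ℝ => (q.1, (q.2 : EReal))) ⁻¹' {p | g p.1 ≤ p.2} := rfl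
    rw [this]
    exact h.preimage (continuous_fst.prodMk (continuous_coe_real_ereal.comp continuous_snd))
  obtain ⟨φ, d, h1, h2⟩ := geometric_hahn_banach_closed_point hg.convex hcl
    (x := (x, c)) (by simpa [epi] using hc)
  have key : ∀ y μ, φ (y, μ) = φ (y, 0) + φ (0, 1) * μ := by
    intro y μ
    have : ((y, μ) : X × ℝ) = (y, 0) + μ • (0, 1) := by simp
    rw [this, map_add, map_smul, smul_eq_mul, mul_comm]
  refine ⟨φ.comp (ContinuousLinearMap.inl ℝ X ℝ), φ (0, 1), d, ?_, ?_, ?_⟩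
  · intro y μ h
    have := h1 (y, μ) h
    rw [key] at this
    simpa using this.le
  · rw [key] at h2
    simpa using h2
  · by_contra! ha
    obtain ⟨y, hy⟩ := hg.nonempty_effDom
    obtain ⟨r, hr⟩ : ∃ r : ℝ, g y = r :=
      ⟨_, (EReal.coe_toReal (ne_of_lt hy) (hg.ne_bot y)).symm⟩
    have h3 := h1 (y, max r ((d - φ (y, 0)) / φ (0, 1))) (by simp [epi, hr])
    rw [key] at h3
    have h4 := mul_le_mul_of_nonneg_left (le_max_right r ((d - φ (y, 0)) / φ (0, 1))) ha.le
    rw [mul_div_cancel₀ _ ha.ne'] at h4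
    linarith

/-- An affine minorant of a proper function gives a point of the graph of the conjugate. -/
theorem IsProperLscConvex.exists_gph_conjugate {g : X → EReal} (hg : IsProperLscConvex g)
    {w : StrongDual ℝ X} {d : ℝ} (h : ∀ y μ, g y ≤ ((μ : ℝ) : EReal) → w y - μ ≤ d) :
    ∃ γ ≤ d, (w, γ) ∈ gph (conjugate g) := by
  have hle : conjugate g w ≤ d := by
    refine iSup_le fun y => ?_
    rcases eq_or_ne (g y) ⊤ with hy | hy
    · simp [hy]
    · lift g y to ℝ using ⟨hy, hg.ne_bot y⟩ with r hr
      have := h y r hr.ge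
      exact_mod_cast this
  obtain ⟨y, hy⟩ := hg.nonempty_effDom
  have hbot : conjugate g w ≠ ⊥ := by
    refine ne_bot_of_le_ne_bot ?_ (le_iSup (fun x => ((w x : ℝ) : EReal) - g x) y)
    have hy' : g y ≠ ⊤ := ne_of_lt hy
    lift g y to ℝ using ⟨hy', hg.ne_bot y⟩ with r hr
    exact_mod_cast EReal.coe_ne_bot (w y - r)
  have htop : conjugate g w ≠ ⊤ := ne_top_of_le_ne_top (EReal.coe_ne_top d) hle
  have heq := EReal.coe_toReal htop hbot
  exact ⟨(conjugate g w).toReal, by rw [← heq] at hle; exact_mod_cast hle, heq.symm⟩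

theorem IsProperLscConvex.exists_gph_conjugate_of_neg {g : X → EReal} (hg : IsProperLscConvex g)
    {w : StrongDual ℝ X} {a d : ℝ} (ha : a < 0)
    (h : ∀ y μ, g y ≤ ((μ : ℝ) : EReal) → w y + a * μ ≤ d) :
    ∃ γ ≤ (-a)⁻¹ * d, ((-a)⁻¹ • w, γ) ∈ gph (conjugate g) := by
  refine hg.exists_gph_conjugate fun y μ hy => ?_
  rw [FunLike.coe_smul, Pi.smul_apply, smul_eq_mul, ← inv_neg_mul_add ha]
  exact mul_le_mul_of_nonneg_left (h y μ hy) (inv_pos.2 (neg_pos.2 ha)).le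

theorem sub_le_of_mem_gph_conjugate {g : X → EReal} {w : StrongDual ℝ X} {γ : ℝ}
    (h : (w, γ) ∈ gph (conjugate g)) {y : X} {s : ℝ} (hs : g y ≤ (s : EReal)) :
    w y - γ ≤ s := by
  have h1 : ((w y : ℝ) : EReal) - g y ≤ γ :=
    (le_iSup (fun x => ((w x : ℝ) : EReal) - g x) y).trans (le_of_eq h)
  have h2 : ((w y : ℝ) : EReal) - s ≤ γ := (EReal.sub_le_sub le_rfl hs).trans h1
  have h3 : w y - s ≤ γ := by exact_mod_cast h2
  linarith

theorem IsProperLscConvex.gph_conjugate_nonempty {g : X → EReal} (hg : IsProperLscConvex g) :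
    (gph (conjugate g)).Nonempty := by
  obtain ⟨x, hx⟩ := hg.nonempty_effDom
  obtain ⟨r, hr⟩ : ∃ r : ℝ, g x = r :=
    ⟨_, (EReal.coe_toReal (ne_of_lt hx) (hg.ne_bot x)).symm⟩
  -- Both `(x, r)` and `(x, r - 1)` lie over `x`, so the hyperplane separating them cannot be
  -- vertical.
  obtain ⟨w, a, d, h1, h2, -⟩ := hg.exists_separation (x := x) (c := r - 1)
    (by rw [hr]; exact_mod_cast sub_one_lt r)
  have ha : a < 0 := by have := h1 x r hr.le; nlinarith
  obtain ⟨γ, -, hγ⟩ := hg.exists_gph_conjugate_of_neg ha h1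
  exact ⟨_, hγ⟩

/-- The Fenchel–Moreau theorem: a proper lower semicontinuous convex function is bounded at `x` by
any bound on its affine minorants of the form `w - g* w`. -/
theorem IsProperLscConvex.le_of_forall_gph_conjugate {g : X → EReal} (hg : IsProperLscConvex g)
    {x : X} {c : ℝ} (h : ∀ w γ, (w, γ) ∈ gph (conjugate g) → w x - γ ≤ c) : g x ≤ c := by
  by_contra! hc
  obtain ⟨w, a, d, h1, h2, ha⟩ := hg.exists_separation hc
  rcases ha.lt_or_eq with ha | rfl
  · obtain ⟨γ, hγd, hγ⟩ := hg.exists_gph_conjugate_of_neg ha h1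
    have h3 := h _ _ hγ
    have h4 := mul_lt_mul_of_pos_left h2 (inv_pos.2 (neg_pos.2 ha))
    have h5 : (-a)⁻¹ * (w x + a * c) = (-a)⁻¹ * w x - c := inv_neg_mul_add ha _ _
    simp only [FunLike.coe_smul, Pi.smul_apply, smul_eq_mul] at h3
    linarith
  -- Vertical hyperplane: `w - d` is nonpositive on the domain and positive at `x`, so adding a
  -- large multiple of it to any affine minorant gives one exceeding `c` at `x`.
  · obtain ⟨⟨w₀, γ₀⟩, h0⟩ := hg.gph_conjugate_nonempty
    simp only [zero_mul, add_zero] at h1 h2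
    obtain ⟨k, hk⟩ := exists_nat_gt ((c + γ₀ - w₀ x) / (w x - d))
    rw [div_lt_iff₀ (by linarith)] at hk
    obtain ⟨γ, hγd, hγ⟩ := hg.exists_gph_conjugate (w := w₀ + (k : ℝ) • w) (d := γ₀ + k * d) (by
      intro y μ hy
      have h3 := mul_le_mul_of_nonneg_left (h1 y μ hy) k.cast_nonneg
      have h4 := sub_le_of_mem_gph_conjugate h0 hy
      simp only [FunLike.coe_add, Pi.add_apply, FunLike.coe_smul, Pi.smul_apply,
        smul_eq_mul]
      linarith)
    have h3 := h _ _ hγ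
    simp only [FunLike.coe_add, Pi.add_apply, FunLike.coe_smul, Pi.smul_apply,
      smul_eq_mul] at h3
    linarith

/-! ### Characteristic set and subgradients of the supremum -/

variable {T : Type*} {f : T → X → EReal}

theorem charSet_zero (f : T → X → EReal) :
    charSet f 0 = convexHull ℝ (⋃ t, gph (conjugate (f t))) := by
  simp [charSet]

theorem sub_le_of_mem_charSet {v : StrongDual ℝ X} {γ : ℝ} (h : (v, γ) ∈ charSet f 0) {y : X}
    {s : ℝ} (hs : ∀ t, f t y ≤ (s : EReal)) : v y - γ ≤ s := by
  rw [charSet_zero] at h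
  have hconv : Convex ℝ {q : StrongDual ℝ X × ℝ | q.1 y - q.2 ≤ s} := by
    intro p hp q hq a b ha hb hab
    simp only [mem_ofPred_eq, Prod.fst_add, Prod.smul_fst, FunLike.coe_add, FunLike.coe_smul,
      Pi.add_apply, Pi.smul_apply, Prod.snd_add, Prod.smul_snd, smul_eq_mul] at hp hq ⊢
    have hs : s = a * s + b * s := by rw [← add_mul, hab, one_mul]
    nlinarith
  refine convexHull_min (iUnion_subset fun t q hq => ?_) hconv h
  exact sub_le_of_mem_gph_conjugate hq (hs t)

theorem sub_le_of_mem_weakStarClosure_charSet {v : StrongDual ℝ X} {γ : ℝ}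
    (h : (v, γ) ∈ weakStarClosure (charSet f 0)) {y : X} {s : ℝ}
    (hs : ∀ t, f t y ≤ (s : EReal)) : v y - γ ≤ s := by
  have hcl : IsClosed {q : WeakDual ℝ X × ℝ | q.1 y - q.2 ≤ s} :=
    isClosed_le (((WeakDual.eval_continuous y).comp continuous_fst).sub continuous_snd)
      continuous_const
  refine closure_minimal ?_ hcl h
  rintro _ ⟨q, hq, rfl⟩
  exact sub_le_of_mem_charSet hq hs

/-- The `ε`-subgradients at `x` of the supremum function of the system, when its value there
is `0`. -/
def supSubdiff (f : T → X → EReal) (x : X) (ε : ℝ) : Set (StrongDual ℝ X) :=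
  {u | ∀ (y : X) (s : ℝ), (∀ t, f t y ≤ (s : EReal)) → u y - u x ≤ s + ε}

/-- Weak*-continuous functionals are evaluations, so a hyperplane in `X^* × ℝ` supplies a point of
`X` at which to test the system. -/
theorem exists_weakDual_prod_eq_apply (φ : StrongDual ℝ (WeakDual ℝ X × ℝ)) :
    ∃ (x : X) (a : ℝ), ∀ v r, φ (v, r) = v x + a * r := by
  obtain ⟨x, hx⟩ := LinearMap.dualEmbedding_surjective (topDualPairing ℝ X)
    (φ.comp (ContinuousLinearMap.inl ℝ (WeakDual ℝ X) ℝ))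
  refine ⟨x, φ (0, 1), fun v r => ?_⟩
  have h1 : ((v, r) : WeakDual ℝ X × ℝ) = (v, 0) + r • (0, 1) := by simp
  have h2 : φ (v, 0) = v x := (DFunLike.congr_fun hx v).symm
  rw [h1, map_add, map_smul, smul_eq_mul, mul_comm, h2]

instance : LocallyConvexSpace ℝ (WeakDual ℝ X) :=
  inferInstanceAs (LocallyConvexSpace ℝ (WeakBilin (topDualPairing ℝ X)))

theorem mem_weakStarClosure_of_mem_supSubdiff (hf : ∀ t, IsProperLscConvex (f t)) {x : X}
    (hx : ∀ t, f t x ≤ 0) {u : StrongDual ℝ X} (hu : u ∈ supSubdiff f x 0) :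
    (u, u x) ∈ weakStarClosure (charSet f 0) := by
  by_contra hnot
  have hconv : Convex ℝ (closure ((fun r : StrongDual ℝ X × ℝ =>
      (StrongDual.toWeakDual r.1, r.2)) '' charSet f 0)) := by
    refine Convex.closure ?_
    exact (convex_convexHull ℝ _).linear_image
      ((StrongDual.toWeakDual (𝕜 := ℝ) (E := X)).toLinearMap.prodMap LinearMap.id)
  obtain ⟨φ, c, h1, h2⟩ := geometric_hahn_banach_closed_point hconv isClosed_closure hnot
  obtain ⟨z, a, hφ⟩ := exists_weakDual_prod_eq_apply φ
  have h1' : ∀ t v γ, (v, γ) ∈ gph (conjugate (f t)) → v z + a * γ < c := by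
    intro t v γ h
    rw [← StrongDual.toWeakDual_apply v z, ← hφ]
    refine h1 _ (subset_closure ⟨(v, γ), ?_, rfl⟩)
    rw [charSet_zero]
    exact subset_convexHull ℝ _ (mem_iUnion.2 ⟨t, h⟩)
  replace h2 : c < u z + a * u x := by
    rw [← StrongDual.toWeakDual_apply u z, ← hφ]
    exact h2
  rcases lt_or_ge a 0 with ha | ha
  -- After scaling, the hyperplane bounds all `f t` at `(-a)⁻¹ • z`, by Fenchel–Moreau.
  · have ha' : 0 < (-a)⁻¹ := inv_pos.2 (neg_pos.2 ha)
    have h3 := hu ((-a)⁻¹ • z) ((-a)⁻¹ * c) (fun t =>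
      (hf t).le_of_forall_gph_conjugate fun v γ h => by
        have h4 := mul_lt_mul_of_pos_left (h1' t v γ h) ha'
        have h5 : (-a)⁻¹ * (v z + a * γ) = (-a)⁻¹ * v z - γ := inv_neg_mul_add ha _ _
        simp only [map_smul, smul_eq_mul]
        linarith)
    have h4 := mul_lt_mul_of_pos_left h2 ha'
    have h5 : (-a)⁻¹ * (u z + a * u x) = (-a)⁻¹ * u z - u x := inv_neg_mul_add ha _ _
    simp only [map_smul, smul_eq_mul] at h3
    linarith
  -- At this point `v - γ` equals `(v z + a * γ) + (1 + a) * (v x - γ)`, which is below `c` because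
  -- `v x - γ ≤ 0`.
  · have h3 := hu (x + (z + a • x)) c (fun t =>
      (hf t).le_of_forall_gph_conjugate fun v γ h => by
        have h4 := h1' t v γ h
        have h5 : v x - γ ≤ 0 := sub_le_of_mem_gph_conjugate h (hx t)
        have h6 := mul_le_mul_of_nonneg_left h5 ha
        simp only [map_add, map_smul, smul_eq_mul]
        linarith)
    simp only [map_add, map_smul, smul_eq_mul] at h3
    linarith

/-- If the ball of radius `m` contains no subgradient, it contains no `ε`-subgradient for
small `ε`. -/
theorem exists_pos_forall_notMem_supSubdiff {x : X} {m : ℝ}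
    (h : ∀ u ∈ supSubdiff f x 0, m < ‖u‖) :
    ∃ ε > 0, ∀ u ∈ supSubdiff f x ε, m < ‖u‖ := by
  by_contra! hcon
  -- Nested weak*-compact sets (Banach–Alaoglu); a common point is a subgradient of norm at most
  -- `m`.
  let K : ℕ → Set (WeakDual ℝ X) := fun n =>
    WeakDual.toStrongDual ⁻¹' (Metric.closedBall 0 m ∩ supSubdiff f x (1 / ((n : ℝ) + 1)))
  have hK : ∀ n, IsClosed (K n) := by
    intro n
    refine (WeakDual.isClosed_closedBall 0 m).inter ?_
    simp only [supSubdiff, ofPred_forall]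
    refine isClosed_iInter fun y => isClosed_iInter fun s => isClosed_iInter fun _ => ?_
    exact isClosed_le ((WeakDual.eval_continuous y).sub (WeakDual.eval_continuous x))
      continuous_const
  have hmono : ∀ n, K (n + 1) ⊆ K n := by
    rintro n u ⟨hu1, hu2⟩
    refine ⟨hu1, fun y s hs => (hu2 y s hs).trans ?_⟩
    have : 1 / (((n + 1 : ℕ) : ℝ) + 1) ≤ 1 / ((n : ℝ) + 1) :=
      Nat.one_div_le_one_div (Nat.le_succ n)
    linarith
  obtain ⟨u, hu⟩ := IsCompact.nonempty_iInter_of_sequence_nonempty_isCompact_isClosed K hmono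
    (fun n => by
      obtain ⟨u, hu1, hu2⟩ := hcon (1 / ((n : ℝ) + 1)) Nat.one_div_pos_of_nat
      exact ⟨StrongDual.toWeakDual u, by simpa using hu2, hu1⟩)
    ((WeakDual.isCompact_closedBall 0 m).of_isClosed_subset (hK 0) inter_subset_left) hK
  rw [mem_iInter] at hu
  have hlt := h (WeakDual.toStrongDual u) (fun y s hs => by
    exact ge_of_tendsto' (tendsto_one_div_add_atTop_nhds_zero_nat.const_add s)
      fun n => (hu n).2 y s hs)
  have := (hu 0).1
  simp only [mem_closedBall_zero_iff] at this
  exact absurd hlt (not_lt.2 this)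

/-! ### Lipschitz estimates -/

/-- If a ball around `x` misses the feasible set of `q`, then the supremum function of the
perturbed system has an affine minorant that is nonnegative on this ball. -/
theorem exists_minorant_of_disjoint (hf : ∀ t, IsProperLscConvex (f t)) {q : LInfty T} {x : X}
    {R r : ℝ} (hR : 0 < R) (hx : ∀ t, f t x ≤ ((q t + r : ℝ) : EReal))
    (hdisj : ∀ y ∈ feasible f q, R ≤ dist y x) :
    ∃ (u : StrongDual ℝ X) (c : ℝ), R * ‖u‖ ≤ u x + c ∧
      ∀ (y : X) (s : ℝ), (∀ t, f t y ≤ ((q t + s : ℝ) : EReal)) → u y + c ≤ s := by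
  let A : Set (X × ℝ) := {p | ∀ t, f t p.1 ≤ ((q t + p.2 : ℝ) : EReal)}
  have hA : Convex ℝ A := by
    intro p hp p' hp' a b ha hb hab t
    have := (hf t).convex (x := (p.1, q t + p.2)) (hp t) (y := (p'.1, q t + p'.2)) (hp' t)
      ha hb hab
    simp only [epi, mem_ofPred_eq, Prod.smul_mk, Prod.mk_add_mk, smul_eq_mul] at this
    have h2 : a * (q t + p.2) + b * (q t + p'.2) = q t + (a * p.2 + b * p'.2) := by
      linear_combination (q t) * hab
    rw [h2] at this
    exact this
  -- A point of `A` at negative height is feasible for `q`, hence not over the open ball.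
  obtain ⟨φ, c, h1, h2⟩ := geometric_hahn_banach_open
    ((convex_ball x R).prod (convex_Iio (0 : ℝ))) (Metric.isOpen_ball.prod isOpen_Iio) hA (by
      rw [Set.disjoint_left]
      rintro ⟨y, s⟩ ⟨hy, hs⟩ hyA
      refine absurd (hdisj y fun t => (hyA t).trans ?_) (not_le.2 hy)
      have : s < 0 := hs
      exact_mod_cast (by linarith : q t + s ≤ q t))
  have key : ∀ y μ, φ (y, μ) = φ (y, 0) + φ (0, 1) * μ := by
    intro y μ
    have : ((y, μ) : X × ℝ) = (y, 0) + μ • (0, 1) := by simp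
    rw [this, map_add, map_smul, smul_eq_mul, mul_comm]
  set w : StrongDual ℝ X := φ.comp (ContinuousLinearMap.inl ℝ X ℝ) with hw
  set a := φ (0, 1)
  have key' : ∀ y μ, φ (y, μ) = w y + a * μ := key
  have hb : ∀ y ∈ Metric.ball x R, ∀ s < (0 : ℝ), w y + a * s < c := fun y hy s hs => by
    rw [← key']; exact h1 _ ⟨hy, hs⟩
  have hAc : ∀ y s, (∀ t, f t y ≤ ((q t + s : ℝ) : EReal)) → c ≤ w y + a * s := fun y s h => by
    rw [← key']; exact h2 _ h
  have hxb := Metric.mem_ball_self (x := x) hR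
  have ha : 0 < a := by
    have hx1 := hAc x (max r 0) fun t => (hx t).trans (by
      exact_mod_cast (by linarith [le_max_left r 0] : q t + r ≤ q t + max r 0))
    have hx2 := hb x hxb (-1) (by norm_num)
    by_contra! ha
    nlinarith [le_max_right r 0]
  have hball : ∀ y ∈ Metric.closedBall x R, w y ≤ c := by
    rw [← closure_ball x hR.ne']
    refine closure_minimal (fun y hy => ?_) (isClosed_le w.continuous continuous_const)
    change w y ≤ c
    refine le_of_forall_pos_le_add fun ε hε => ?_
    have := hb y hy (-(ε / a)) (neg_lt_zero.2 (div_pos hε ha))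
    rw [mul_neg, mul_div_cancel₀ _ ha.ne'] at this
    linarith
  have hnorm : ‖w‖ ≤ (c - w x) / R := by
    refine ContinuousLinearMap.opNorm_bound_of_ball_bound hR _ w fun z hz => ?_
    rw [mem_closedBall_zero_iff] at hz
    have h3 := hball (x + z) (by simpa using hz)
    have h4 := hball (x - z) (by simpa [dist_eq_norm] using hz)
    rw [map_add] at h3
    rw [map_sub] at h4
    rw [Real.norm_eq_abs, abs_le]
    constructor <;> linarith
  rw [le_div_iff₀ hR] at hnorm
  refine ⟨-(a⁻¹ • w), a⁻¹ * c, ?_, fun y s hs => ?_⟩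
  · rw [norm_neg, norm_smul, norm_inv, Real.norm_eq_abs, abs_of_pos ha]
    have := mul_le_mul_of_nonneg_left hnorm (inv_pos.2 ha).le
    simp only [FunLike.coe_neg, Pi.neg_apply, FunLike.coe_smul, Pi.smul_apply, smul_eq_mul]
    linarith
  · have h3 := mul_le_mul_of_nonneg_left (hAc y s hs) (inv_pos.2 ha).le
    have h4 : a⁻¹ * (w y + a * s) = a⁻¹ * w y + s := by field_simp
    simp only [FunLike.coe_neg, Pi.neg_apply, FunLike.coe_smul, Pi.smul_apply, smul_eq_mul]
    linarith

theorem abs_apply_le_norm (p : LInfty T) (t : T) : |p t| ≤ ‖p‖ :=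
  lp.norm_apply_le_norm ENNReal.top_ne_zero p t

/-- A modulus whose reciprocal is below the norms of all subgradients is a Lipschitz modulus of
the feasible solution map. -/
theorem lipschitzLikeWith_of_forall_supSubdiff (hf : ∀ t, IsProperLscConvex (f t)) {x₀ : X}
    {ℓ : ℝ≥0} (hℓ : 0 < ℓ) (h : ∀ u ∈ supSubdiff f x₀ 0, (ℓ : ℝ)⁻¹ < ‖u‖) :
    LipschitzLikeWith (feasible f) 0 x₀ ℓ := by
  obtain ⟨ε, hε, hlt⟩ := exists_pos_forall_notMem_supSubdiff h
  have hℓ' : (0 : ℝ) < ℓ := hℓ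
  have hm : (0 : ℝ) < (ℓ : ℝ)⁻¹ := inv_pos.2 hℓ'
  -- Moving the base point from `x` to `x₀` costs at most `ℓ⁻¹ * δ`, removing `q` costs at most `δ`;
  -- together `ε`.
  set δ := ε / ((ℓ : ℝ)⁻¹ + 1) with hδ
  have hδ0 : 0 < δ := by positivity
  have hδε : (ℓ : ℝ)⁻¹ * δ + δ = ε := by rw [hδ]; field_simp
  refine ⟨Metric.ball 0 δ, Metric.ball_mem_nhds _ hδ0, Metric.ball x₀ δ,
    Metric.ball_mem_nhds _ hδ0, ?_⟩
  rintro p - q hq x ⟨hxp, hxV⟩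
  rcases eq_or_ne p q with rfl | hpq
  · exact ⟨x, hxp, 0, by simp, by simp⟩
  have hr : 0 < ‖p - q‖ := norm_pos_iff.2 (sub_ne_zero.2 hpq)
  set r := ‖p - q‖
  by_contra hnot
  have hfar : ∀ y ∈ feasible f q, (ℓ : ℝ) * r ≤ dist y x := by
    intro y hy
    by_contra! hd
    refine hnot ⟨y, hy, x - y, ?_, by simp⟩
    rw [smul_unitClosedBall_of_nonneg (by positivity), mem_closedBall_zero_iff, ← dist_eq_norm,
      dist_comm]
    exact hd.le
  have hxq : ∀ t, f t x ≤ ((q t + r : ℝ) : EReal) := fun t => (hxp t).trans (by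
    have := (le_abs_self _).trans (abs_apply_le_norm (p - q) t)
    simp only [lp.coeFn_sub, Pi.sub_apply] at this
    exact_mod_cast (by linarith : p t ≤ q t + r))
  obtain ⟨u, c, hu, hmin⟩ := exists_minorant_of_disjoint hf (mul_pos hℓ' hr) hxq hfar
  have hux := hmin x r hxq
  -- `u x + c` is at least `ℓ * r * ‖u‖` and at most `r`.
  have hunorm : ‖u‖ ≤ (ℓ : ℝ)⁻¹ := by
    rw [← one_div, le_div_iff₀ hℓ']
    have : (ℓ * ‖u‖) * r ≤ 1 * r := by linarith
    linarith [le_of_mul_le_mul_right this hr]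
  refine absurd (hlt u fun y s hs => ?_) (not_lt.2 hunorm)
  have hqn : ‖q‖ < δ := by simpa using hq
  have h1 := hmin y (s + ‖q‖) fun t => (hs t).trans (by
    have := (abs_le.1 (abs_apply_le_norm q t)).1
    exact_mod_cast (by linarith : s ≤ q t + (s + ‖q‖)))
  have h2 : u x - u x₀ ≤ (ℓ : ℝ)⁻¹ * δ := by
    rw [← map_sub]
    refine (le_abs_self _).trans ((u.le_opNorm _).trans ?_)
    rw [Metric.mem_ball, dist_eq_norm] at hxV
    exact mul_le_mul hunorm hxV.le (norm_nonneg _) hm.le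
  have h3 : 0 ≤ ℓ * r * ‖u‖ := by positivity
  linarith

/-- Every Lipschitz modulus of the feasible solution map is bounded below by the reciprocal norms
of the subgradients. -/
theorem one_le_mul_norm_of_lipschitzLikeWith {x₀ : X} (hx₀ : x₀ ∈ feasible f 0) {ℓ : ℝ≥0}
    (h : LipschitzLikeWith (feasible f) 0 x₀ ℓ) {u : StrongDual ℝ X}
    (hu : u ∈ supSubdiff f x₀ 0) : 1 ≤ ‖u‖ * ℓ := by
  obtain ⟨U, hU, V, hV, hUV⟩ := h
  let one : LInfty T := ⟨fun _ => 1, memℓp_infty ⟨1, by rintro _ ⟨t, rfl⟩; simp⟩⟩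
  -- Only an inequality: the norm is `0` when `T` is empty.
  have hone : ‖one‖ ≤ 1 := lp.norm_le_of_forall_le zero_le_one fun t => by simp [one]
  have hcont : Filter.Tendsto (fun ε : ℝ => (-ε) • one) (𝓝[>] 0) (𝓝 0) := by
    have : Continuous fun ε : ℝ => (-ε) • one := by fun_prop
    exact (this.tendsto' 0 0 (by simp)).mono_left nhdsWithin_le_nhds
  obtain ⟨ε, hεU, hε⟩ := ((hcont.eventually hU).and self_mem_nhdsWithin).exists
  have hε : 0 < ε := hε
  obtain ⟨y, hy, z, hz, hyz⟩ := hUV 0 (mem_of_mem_nhds hU) _ hεU ⟨hx₀, mem_of_mem_nhds hV⟩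
  have h1 := hu y (-ε) fun t => (hy t).trans_eq <| by
    simp only [lp.coeFn_smul, Pi.smul_apply, smul_eq_mul, one, mul_one]
  have hz' : ‖z‖ ≤ ℓ * ε := by
    rw [smul_unitClosedBall_of_nonneg (by positivity), mem_closedBall_zero_iff] at hz
    refine hz.trans (mul_le_mul_of_nonneg_left ?_ ℓ.2)
    rw [zero_sub, norm_neg, norm_smul, norm_neg, Real.norm_eq_abs, abs_of_pos hε]
    exact mul_le_of_le_one_right hε.le hone
  have h2 : u x₀ - u y ≤ ‖u‖ * (ℓ * ε) := by
    have : x₀ - y = z := by rw [← hyz]; simp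
    rw [← map_sub, this]
    exact (le_abs_self _).trans ((u.le_opNorm _).trans
      (mul_le_mul_of_nonneg_left hz' (norm_nonneg _)))
  have h3 : 1 * ε ≤ (‖u‖ * ℓ) * ε := by linarith
  exact le_of_mul_le_mul_right h3 hε

theorem mem_supSubdiff_iff (hf : ∀ t, IsProperLscConvex (f t)) {x : X} (hx : x ∈ feasible f 0)
    {u : StrongDual ℝ X} :
    u ∈ supSubdiff f x 0 ↔ (u, u x) ∈ weakStarClosure (charSet f 0) := by
  refine ⟨mem_weakStarClosure_of_mem_supSubdiff hf fun t => by simpa using hx t,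
    fun h y s hs => ?_⟩
  rw [add_zero]
  exact sub_le_of_mem_weakStarClosure_charSet h hs

/-- The formula for the exact Lipschitzian bound at an arbitrary feasible point. -/
theorem lip_feasible_eq (hf : ∀ t, IsProperLscConvex (f t)) {x : X} (hx : x ∈ feasible f 0) :
    lip (feasible f) 0 x =
      ⨆ u ∈ {u : StrongDual ℝ X | (u, u x) ∈ weakStarClosure (charSet f 0)}, ‖u‖ₑ⁻¹ := by
  refine le_antisymm (le_of_forall_gt fun b hb => ?_) ?_
  · obtain ⟨ℓ, hℓ1, hℓ2⟩ := ENNReal.lt_iff_exists_nnreal_btwn.1 hb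
    refine lt_of_le_of_lt (iInf₂_le ℓ ?_) hℓ2
    have hℓ : 0 < ℓ := ENNReal.coe_pos.1 (bot_le.trans_lt hℓ1)
    refine lipschitzLikeWith_of_forall_supSubdiff hf hℓ fun u hu => ?_
    have h1 : ‖u‖ₑ⁻¹ < ℓ := lt_of_le_of_lt
      (le_iSup₂ (f := fun (u : StrongDual ℝ X) (_ : u ∈ {u : StrongDual ℝ X |
        (u, u x) ∈ weakStarClosure (charSet f 0)}) => ‖u‖ₑ⁻¹) u ((mem_supSubdiff_iff hf hx).1 hu)) hℓ1
    rw [ENNReal.inv_lt_iff_inv_lt, ← ENNReal.coe_inv hℓ.ne'] at h1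
    have h2 : ℓ⁻¹ < ‖u‖₊ := ENNReal.coe_lt_coe.1 h1
    exact_mod_cast h2
  · refine iSup₂_le fun u hu => le_iInf₂ fun ℓ hℓ => ?_
    have h1 := one_le_mul_norm_of_lipschitzLikeWith hx hℓ ((mem_supSubdiff_iff hf hx).2 hu)
    have h2 : (1 : ℝ≥0) ≤ ‖u‖₊ * ℓ := by exact_mod_cast h1
    have h3 : (1 : ℝ≥0∞) ≤ ‖u‖ₑ * ℓ := by
      simpa [enorm_eq_nnnorm] using ENNReal.coe_le_coe.2 h2
    exact ENNReal.inv_le_iff_le_mul (by simp) (by simp) |>.2 h3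

/-- Testing the subgradient inequality at `x` itself with a negative bound `s` gives `0 ≤ s`. -/
theorem supSubdiff_eq_empty_of_isStrongSlaterPoint {x : X} (hx : IsStrongSlaterPoint f x) :
    supSubdiff f x 0 = ∅ := by
  obtain ⟨s, hs, hs0⟩ := EReal.lt_iff_exists_real_btwn.1 hx
  refine eq_empty_of_forall_notMem fun u hu => ?_
  have h1 := hu x s fun t => (le_iSup (fun t => f t x) t).trans hs.le
  have h2 : s < 0 := by exact_mod_cast hs0
  linarith

end Aux

end ConvexSystem

theorem mainTheorem2 {X : Type*} [NormedAddCommGroup X] [NormedSpace ℝ X] [CompleteSpace X]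
    (hX : ConvexSystem.IsReflexive X) {T : Type*} (f : T → X → EReal)
    (hf : ∀ t, ConvexSystem.IsProperLscConvex (f t)) (xbar : X)
    (hxbar : xbar ∈ ConvexSystem.feasible f 0)
    (hSSC : ConvexSystem.StrongSlaterCondition f) :
    (ConvexSystem.IsStrongSlaterPoint f xbar →
      ConvexSystem.lip (ConvexSystem.feasible f) 0 xbar = 0) ∧
    (¬ ConvexSystem.IsStrongSlaterPoint f xbar →
      ConvexSystem.lip (ConvexSystem.feasible f) 0 xbar =
        ⨆ u ∈ {u : StrongDual ℝ X | (u, u xbar) ∈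
          ConvexSystem.weakStarClosure (ConvexSystem.charSet f 0)}, ‖u‖ₑ⁻¹) := by
  refine ⟨fun h => ?_, fun _ => ConvexSystem.lip_feasible_eq hf hxbar⟩
  rw [ConvexSystem.lip_feasible_eq hf hxbar]
  have hempty := ConvexSystem.supSubdiff_eq_empty_of_isStrongSlaterPoint h
  have : ∀ u : StrongDual ℝ X,
      (u, u xbar) ∉ ConvexSystem.weakStarClosure (ConvexSystem.charSet f 0) := fun u hu =>
    Set.eq_empty_iff_forall_notMem.1 hempty u ((ConvexSystem.mem_supSubdiff_iff hf hxbar).2 hu)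
  simp [this]
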